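/- All groups are finite. For an irreducible complex character $\chi$ of a group $G$, let $\mathbb{Q}(\chi)=\mathbb{Q}(\chi(g)\mid g\in G)$. The group $G$ is called \emph{quadratic rational} if $[\mathbb{Q}(\chi):\mathbb{Q}]\le 2$ for every irreducible complex character $\chi$ of $G$, and \emph{rational} if all values of all irreducible complex characters of $G$ are rational. For an integer $r$, an element $x\in G$ is called \emph{$r$-semi-rational} if, for every integer $j$ coprime to the order of $x$, the element $x^j$ is conjugate in $G$ to $x$ or to $x^r$. The group $G$ is \emph{semi-rational} if every $x\in G$ is $r_x$-semi-rational for some integer $r_x$ (depending on $x$); it is \emph{$r$-semi-rational} if every $x\in G$ is $r$-semi-rational for the same integer $r$, and \emph{inverse semi-rational} if it is $(-1)$-semi-rational. If $n$ is the exponent of $G$, the \emph{semi-rationality} of $G$ is the set $\mathcal{S}_G$ of all units $s\in\mathcal{U}(\mathbb{Z}/n\mathbb{Z})$ such that $G$ is $s$-semi-rational (this depends only on $s$ modulo $n$). Let $G$ be a finite $2$-group of nilpotency class at most $2$ that is quadratic rational or semi-rational. Then: \begin{enumerate} \item $G/Z(G)$ and $Z(G)$ are abelian groups whose exponents divide $4$.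 \item $G$ is rational, or $G$ is inverse semi-rational with semi-rationality $\mathcal{S}_G=-1\cdot\langle 5\rangle$, where $\langle 5\rangle$ is the subgroup of $\mathcal{U}(\mathbb{Z}/n\mathbb{Z})$ generated by the class of $5$ and $n$ is the exponent of $G$. \end{enumerate} -/

import Mathlib

open scoped Pointwise

/-- The set of irreducible complex characters of `G`. For a finite group, every irreducible complex
representation is finite-dimensional, hence isomorphic to one on some `ℂⁿ`. -/
def irrChar (G : Type*) [Group G] : Set (G → ℂ) :=
  {χ | ∃ (n : ℕ) (ρ : Representation ℂ G (Fin n → ℂ)), ρ.IsIrreducible ∧ ρ.character = χ}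

/-- The field of values `ℚ(χ) = ℚ(χ(g) ∣ g ∈ G)`, a subfield of `ℂ`. -/
noncomputable def fieldOfValues {G : Type*} (χ : G → ℂ) : IntermediateField ℚ ℂ :=
  IntermediateField.adjoin ℚ (Set.range χ)

/-- `G` is quadratic rational: the field of values of every irreducible complex character has
degree at most `2` over `ℚ`. -/
def IsQuadraticRational (G : Type*) [Group G] : Prop :=
  ∀ χ ∈ irrChar G, Module.rank ℚ (fieldOfValues χ) ≤ 2

/-- `G` is rational: all entries of its complex character table are rational numbers. -/
def IsRationalGroup (G : Type*) [Group G] : Prop :=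
  ∀ χ ∈ irrChar G, ∀ g : G, ∃ q : ℚ, χ g = (q : ℂ)

/-- The element `x` is `r`-semi-rational in `G`: for every integer `j` coprime to the order of `x`,
`x ^ j` is conjugate in `G` to `x` or to `x ^ r`. -/
def IsSemiRationalElement {G : Type*} [Group G] (r : ℤ) (x : G) : Prop :=
  ∀ j : ℤ, IsCoprime j (orderOf x : ℤ) → IsConj (x ^ j) x ∨ IsConj (x ^ j) (x ^ r)

/-- `G` is semi-rational: every `x` is `r`-semi-rational for some `r` that may depend on `x`. -/
def IsSemiRational (G : Type*) [Group G] : Prop :=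
  ∀ x : G, ∃ r : ℤ, IsSemiRationalElement r x

/-- `G` is `r`-semi-rational: every element is `r`-semi-rational, for the same integer `r`. -/
def IsUniformlySemiRational (r : ℤ) (G : Type*) [Group G] : Prop :=
  ∀ x : G, IsSemiRationalElement r x

/-- `G` is inverse semi-rational. -/
def IsInverseSemiRational (G : Type*) [Group G] : Prop :=
  IsUniformlySemiRational (-1) G

/-- Whether `G` is `r`-semi-rational depends only on `r` modulo the exponent of `G`. -/
theorem IsUniformlySemiRational.congr {G : Type*} [Group G] {r s : ℤ}
    (h : (r : ZMod (Monoid.exponent G)) = s) (hr : IsUniformlySemiRational r G) :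
    IsUniformlySemiRational s G := by
  intro x j hj
  have hx : x ^ r = x ^ s := by
    rw [zpow_eq_zpow_iff_modEq]
    exact ((ZMod.intCast_eq_intCast_iff _ _ _).1 h).of_dvd
      (Int.natCast_dvd_natCast.2 (Monoid.order_dvd_exponent x))
  rw [← hx]
  exact hr x j hj

/-- The semi-rationality `S_G`: the set of units `s` modulo the exponent of `G` such that `G` is
`s`-semi-rational. -/
def semiRationality (G : Type*) [Group G] : Set (ZMod (Monoid.exponent G))ˣ :=
  {s | ∃ r : ℤ, (r : ZMod (Monoid.exponent G)) = s ∧ IsUniformlySemiRational r G}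

open scoped commutatorElement

/-! ### Conjugacy of powers in class two -/

section ClassTwo

variable {G : Type*} [Group G]

/-! In class two, N_x = {[g, x]} is a central subgroup (the range of `commutatorHom`) and the class
of x is the coset N_x x. So x^j is conjugate to x iff x^(j-1) ∈ N_x, and to x⁻¹ iff x^(j+1) ∈ N_x.
Either hypothesis forces x^4 ∈ N_x for every x (the two `pow_four_mem` lemmas). Hence x^4 is
central, and x^4 = 1 when x is central, since then N_x = 1; this bounds both exponents. If x^2 ∈ N_x
for all x, all odd powers of x are conjugate and G is rational. Otherwise some y has y^2 ∉ N_y, and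
G is r-semi-rational exactly when r ≡ -1 mod 4. The exponent is then 4, 8 or 16, where these
residues form -⟨5⟩. -/

theorem commutatorElement_mem_center_of_nilpotencyClass_le_two [Group.IsNilpotent G]
    (h : Group.nilpotencyClass G ≤ 2) (a b : G) : ⁅a, b⁆ ∈ Subgroup.center G := by
  have htop := Subgroup.upperCentralSeries_eq_top_iff_nilpotencyClass_le.2 h
  have ha : a ∈ Subgroup.upperCentralSeries G (1 + 1) := by rw [htop]; trivial
  rw [Subgroup.mem_upperCentralSeries_succ_iff] at ha
  simpa [commutatorElement_def, Subgroup.upperCentralSeries_one] using ha b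

/-- In a group whose commutators are central, `g ↦ ⁅g, x⁆` is a homomorphism. -/
def commutatorHom (hc : ∀ a b : G, ⁅a, b⁆ ∈ Subgroup.center G) (x : G) : G →* G where
  toFun g := ⁅g, x⁆
  map_one' := commutatorElement_one_left x
  map_mul' a b := by
    have h := Subgroup.mem_center_iff.1 (hc b x)
    calc ⁅a * b, x⁆ = a * ⁅b, x⁆ * a⁻¹ * ⁅a, x⁆ := by simp only [commutatorElement_def]; group
      _ = ⁅a, x⁆ * ⁅b, x⁆ := by rw [h a, mul_inv_cancel_right, h]

variable (hc : ∀ a b : G, ⁅a, b⁆ ∈ Subgroup.center G) {x : G}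

include hc

theorem commutatorElement_zpow_right (g x : G) (j : ℤ) : ⁅g, x ^ j⁆ = ⁅g, x⁆ ^ j := by
  have h := Subgroup.mem_center_iff.1 (hc g x)
  have hcomm : Commute ⁅g, x⁆ x := (h x).symm
  have h1 : g * x * g⁻¹ = ⁅g, x⁆ * x := by simp [commutatorElement_def]
  rw [commutatorElement_def, ← conj_zpow, h1, hcomm.mul_zpow, mul_inv_cancel_right]

theorem range_commutatorHom_le_center (x : G) :
    (commutatorHom hc x).range ≤ Subgroup.center G := by
  rintro _ ⟨g, rfl⟩
  exact hc g x

theorem isConj_zpow_self_iff (j : ℤ) :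
    IsConj (x ^ j) x ↔ x ^ (j - 1) ∈ (commutatorHom hc x).range := by
  rw [isConj_comm, isConj_iff]
  refine exists_congr fun c ↦ ?_
  change _ ↔ c * x * c⁻¹ * x⁻¹ = _
  rw [mul_inv_eq_iff_eq_mul (b := x), ← zpow_add_one, sub_add_cancel]

/-- Inverting both sides reduces this to conjugacy of x^(-j) with x. -/
theorem isConj_zpow_inv_iff (j : ℤ) :
    IsConj (x ^ j) (x ^ (-1 : ℤ)) ↔ x ^ (j + 1) ∈ (commutatorHom hc x).range := by
  have h := isConj_zpow_self_iff hc (x := x) (-j)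
  rw [← inv_mem_iff, ← zpow_neg, neg_add', ← h, isConj_iff, isConj_iff]
  refine exists_congr fun c ↦ ?_
  rw [← inv_inj (a := c * x ^ j * c⁻¹), conj_inv, ← zpow_neg, ← zpow_neg, neg_neg, zpow_one]

/-- If c conjugates x^j to x^r, then x^(r-j) = [c, x^j] = [c, x]^j. -/
theorem zpow_sub_mem_of_isConj {j r : ℤ} (h : IsConj (x ^ j) (x ^ r)) :
    x ^ (r - j) ∈ (commutatorHom hc x).range := by
  obtain ⟨c, h⟩ := isConj_iff.1 h
  have : x ^ (r - j) = (commutatorHom hc x c) ^ j := by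
    change _ = ⁅c, x⁆ ^ j
    rw [← commutatorElement_zpow_right hc, commutatorElement_def, h, zpow_sub]
  rw [this]
  exact zpow_mem (MonoidHom.mem_range.2 ⟨c, rfl⟩) j

end ClassTwo

/-- Bézout: gcd(k, 4) divides 2. -/
theorem zpow_two_mem_of_zpow_mem {G : Type*} [Group G] {N : Subgroup G} {x : G}
    (h4 : x ^ 4 ∈ N) {k : ℤ} (hk : x ^ k ∈ N) (hk4 : ¬ (4 : ℤ) ∣ k) : x ^ 2 ∈ N := by
  have h4' : x ^ (4 : ℤ) ∈ N := by exact_mod_cast h4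
  suffices x ^ (2 : ℤ) ∈ N by exact_mod_cast this
  obtain h | h | h : k % 4 = 1 ∨ k % 4 = 2 ∨ k % 4 = 3 := by omega
  · have : x ^ (2 : ℤ) = (x ^ k) ^ 2 * (x ^ (4 : ℤ)) ^ (-(2 * (k / 4))) := by
      rw [← zpow_natCast, ← zpow_mul, ← zpow_mul, ← zpow_add]; congr 1; push_cast; omega
    rw [this]; exact mul_mem (pow_mem hk _) (zpow_mem h4' _)
  · have : x ^ (2 : ℤ) = (x ^ k) * (x ^ (4 : ℤ)) ^ (-(k / 4)) := by
      rw [← zpow_mul, ← zpow_add]; congr 1; omega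
    rw [this]; exact mul_mem hk (zpow_mem h4' _)
  · have : x ^ (2 : ℤ) = (x ^ k) ^ 2 * (x ^ (4 : ℤ)) ^ (-(2 * (k / 4) + 1)) := by
      rw [← zpow_natCast, ← zpow_mul, ← zpow_mul, ← zpow_add]; congr 1; push_cast; omega
    rw [this]; exact mul_mem (pow_mem hk _) (zpow_mem h4' _)

theorem zpow_mem_of_four_dvd {G : Type*} [Group G] {N : Subgroup G} {x : G}
    (h4 : x ^ 4 ∈ N) {k : ℤ} (hk : (4 : ℤ) ∣ k) : x ^ k ∈ N := by
  obtain ⟨m, rfl⟩ := hk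
  rw [zpow_mul]
  exact zpow_mem (by exact_mod_cast h4) m

/-! ### Semi-rationality in 2-groups of class two -/

section TwoGroup

variable {G : Type*} [Group G]

theorem IsPGroup.isCoprime_orderOf_of_odd (h2 : IsPGroup 2 G) (x : G) {j : ℤ} (hj : Odd j) :
    IsCoprime j (orderOf x : ℤ) := by
  obtain ⟨k, hk⟩ := h2 x
  obtain ⟨m, -, hm⟩ := (Nat.dvd_prime_pow Nat.prime_two).1 (orderOf_dvd_of_pow_eq_one hk)
  rw [hm]
  push_cast
  exact (Int.isCoprime_two_right.2 hj).pow_right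

theorem IsPGroup.odd_of_isCoprime_orderOf (h2 : IsPGroup 2 G) {x : G} (hx : x ≠ 1) {j : ℤ}
    (hj : IsCoprime j (orderOf x : ℤ)) : Odd j := by
  obtain ⟨k, hk⟩ := h2 x
  obtain ⟨m, -, hm⟩ := (Nat.dvd_prime_pow Nat.prime_two).1 (orderOf_dvd_of_pow_eq_one hk)
  have h : 2 ∣ orderOf x := by
    rw [hm]
    refine dvd_pow_self 2 ?_
    rintro rfl
    exact hx (orderOf_eq_one_iff.1 (by simpa using hm))
  exact Int.isCoprime_two_right.1 (hj.of_isCoprime_of_dvd_right (by exact_mod_cast h))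

variable (hc : ∀ a b : G, ⁅a, b⁆ ∈ Subgroup.center G)

include hc

/-- Pigeonhole on x, x^3, x^5, which meet at most two classes: some two are conjugate, so x^2 or x^4
lies in N_x. -/
theorem IsSemiRational.pow_four_mem (h2 : IsPGroup 2 G) (hG : IsSemiRational G) (x : G) :
    x ^ 4 ∈ (commutatorHom hc x).range := by
  obtain ⟨r, hr⟩ := hG x
  have h3 := hr 3 (h2.isCoprime_orderOf_of_odd x (by decide))
  have h5 := hr 5 (h2.isCoprime_orderOf_of_odd x (by decide))
  rw [isConj_zpow_self_iff hc] at h3 h5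
  have key : x ^ (2 : ℤ) ∈ (commutatorHom hc x).range → x ^ 4 ∈ (commutatorHom hc x).range := by
    intro h
    have := pow_mem h 2
    rwa [← zpow_natCast, ← zpow_mul, show (2 : ℤ) * (2 : ℕ) = (4 : ℕ) by norm_num,
      zpow_natCast] at this
  rcases h3 with h3 | h3
  · exact key h3
  rcases h5 with h5 | h5
  · exact (zpow_natCast x 4 ▸ h5 : _)
  · refine key ?_
    have := mul_mem (zpow_sub_mem_of_isConj hc h3) (inv_mem (zpow_sub_mem_of_isConj hc h5))
    rwa [← zpow_neg, ← zpow_add, show r - 3 + -(r - 5) = 2 by ring] at this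

theorem isUniformlySemiRational_of_pow_four_mem (h2 : IsPGroup 2 G)
    (h4 : ∀ x, x ^ 4 ∈ (commutatorHom hc x).range) {r : ℤ} (hr : 4 ∣ r + 1) :
    IsUniformlySemiRational r G := by
  intro x j hj
  -- Only the identity has order coprime to even j; otherwise j is odd, so ±1 mod 4.
  by_cases hx : x = 1
  · subst hx; simp
  obtain ⟨m, rfl⟩ := h2.odd_of_isCoprime_orderOf hx hj
  obtain h | h : (4 : ℤ) ∣ (2 * m + 1) - 1 ∨ (4 : ℤ) ∣ (2 * m + 1) + 1 := by omega
  · exact .inl ((isConj_zpow_self_iff hc _).2 (zpow_mem_of_four_dvd (h4 x) h))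
  · exact .inr (((isConj_zpow_inv_iff hc _).2 (zpow_mem_of_four_dvd (h4 x) h)).trans
      ((isConj_zpow_inv_iff hc _).2 (zpow_mem_of_four_dvd (h4 x) hr)).symm)

/-- Test y with j = 3: y^3 is not conjugate to y, so y^(r-3) ∈ N_y, which forces 4 ∣ r - 3. -/
theorem isUniformlySemiRational_iff (h2 : IsPGroup 2 G)
    (h4 : ∀ x, x ^ 4 ∈ (commutatorHom hc x).range) {y : G}
    (hy : y ^ 2 ∉ (commutatorHom hc y).range) {r : ℤ} :
    IsUniformlySemiRational r G ↔ 4 ∣ r + 1 := by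
  refine ⟨fun h ↦ ?_, isUniformlySemiRational_of_pow_four_mem hc h2 h4⟩
  rcases h y 3 (h2.isCoprime_orderOf_of_odd y (by decide)) with h | h
  · exact absurd (zpow_natCast y 2 ▸ (isConj_zpow_self_iff hc 3).1 h) hy
  · by_contra hr
    exact hy (zpow_two_mem_of_zpow_mem (h4 y) (zpow_sub_mem_of_isConj hc h) (by omega))

theorem pow_four_eq_one_of_mem_center (h4 : ∀ x, x ^ 4 ∈ (commutatorHom hc x).range) {x : G}
    (hx : x ∈ Subgroup.center G) : x ^ 4 = 1 := by
  obtain ⟨g, hg⟩ := h4 x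
  rw [← hg]
  exact commutatorElement_eq_one_iff_mul_comm.2 (Subgroup.mem_center_iff.1 hx g)

end TwoGroup

/-! ### The coset -⟨5⟩ of units -/

theorem mem_neg_one_smul_zpowers_five_iff {n : ℕ} (hn : n = 4 ∨ n = 8 ∨ n = 16) :
    ∃ u : (ZMod n)ˣ, (u : ZMod n) = 5 ∧ ∀ s : (ZMod n)ˣ,
      s ∈ (-1 : (ZMod n)ˣ) • (Subgroup.zpowers u : Set (ZMod n)ˣ) ↔
        ∃ r : ℤ, (r : ZMod n) = s ∧ 4 ∣ r + 1 := by
  have hcop : Nat.Coprime 5 n := by rcases hn with rfl | rfl | rfl <;> decide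
  have h4n : 4 ∣ n := by rcases hn with rfl | rfl | rfl <;> decide
  have hn0 : NeZero n := ⟨by omega⟩
  refine ⟨ZMod.unitOfCoprime 5 hcop, by simp, fun s ↦ ?_⟩
  have hiff : (∃ r : ℤ, (r : ZMod n) = s ∧ 4 ∣ r + 1) ↔ ZMod.castHom h4n (ZMod 4) s = -1 := by
    have hr4 : ∀ r : ℤ, 4 ∣ r + 1 ↔ (r : ZMod 4) = -1 := fun r ↦ by
      rw [eq_neg_iff_add_eq_zero]
      exact_mod_cast (ZMod.intCast_zmod_eq_zero_iff_dvd (r + 1) 4).symm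
    constructor
    · rintro ⟨r, hr, h⟩
      rwa [← hr, map_intCast, ← hr4]
    · intro h
      obtain ⟨r, hr⟩ := ZMod.intCast_surjective (s : ZMod n)
      refine ⟨r, hr, (hr4 r).2 ?_⟩
      rw [← h, ← hr, map_intCast]
  rw [hiff, Set.mem_smul_set]
  constructor
  · rintro ⟨v, hv, rfl⟩
    rw [SetLike.mem_coe, ← mem_powers_iff_mem_zpowers] at hv
    obtain ⟨k, rfl⟩ := hv
    have h5 : ((5 : ℕ) : ZMod 4) = 1 := by decide
    simp only [smul_eq_mul, Units.val_mul, Units.val_neg, Units.val_one, Units.val_pow_eq_pow_val,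
      ZMod.coe_unitOfCoprime, map_mul, map_neg, map_one, map_pow, map_natCast, h5, one_pow, mul_one]
  · intro h
    -- Four exponents suffice: 5 has order 1, 2, 4 modulo 4, 8, 16.
    have key : ∀ t : ZMod n, ZMod.castHom h4n (ZMod 4) t = -1 → ∃ k : Fin 4, t = -5 ^ (k : ℕ) := by
      clear hiff h s
      rcases hn with rfl | rfl | rfl <;> decide +revert
    obtain ⟨k, hk⟩ := key s h
    refine ⟨_, Subgroup.npow_mem_zpowers _ k, Units.ext ?_⟩
    simp [hk]

-- Irreducible representations and traces

universe u

namespace Representation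

variable {G V : Type*} [Group G] [AddCommGroup V] [Module ℂ V]

theorem IsIrreducible.eq_bot_or_eq_top {ρ : Representation ℂ G V} (h : ρ.IsIrreducible)
    (W : Submodule ℂ V) (hW : ∀ g, ∀ v ∈ W, ρ g v ∈ W) : W = ⊥ ∨ W = ⊤ := by
  rcases IsSimpleOrder.eq_bot_or_eq_top (⟨W, fun g _ ↦ hW g _⟩ : Subrepresentation ρ) with h | h
  · exact .inl (congrArg Subrepresentation.toSubmodule h)
  · exact .inr (congrArg Subrepresentation.toSubmodule h)

theorem IsIrreducible.nontrivial_space {ρ : Representation ℂ G V} (h : ρ.IsIrreducible) :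
    Nontrivial V := by
  by_contra hV
  rw [not_nontrivial_iff_subsingleton] at hV
  exact bot_ne_top (α := Subrepresentation ρ)
    (Subrepresentation.toSubmodule_injective (Subsingleton.elim _ _))

theorem isIrreducible_of_forall [Nontrivial V] {ρ : Representation ℂ G V}
    (h : ∀ W : Submodule ℂ V, (∀ g, ∀ v ∈ W, ρ g v ∈ W) → W = ⊥ ∨ W = ⊤) : ρ.IsIrreducible where
  exists_pair_ne := ⟨⊥, ⊤, fun h ↦
    bot_ne_top (α := Submodule ℂ V) (congrArg Subrepresentation.toSubmodule h)⟩
  eq_bot_or_eq_top W := (h W.toSubmodule fun g _ hv ↦ W.apply_mem_toSubmodule g hv).imp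
    (fun h ↦ Subrepresentation.toSubmodule_injective h)
    (fun h ↦ Subrepresentation.toSubmodule_injective h)

/-- An irreducible representation of a quotient, transported to a coordinate space and inflated. -/
theorem IsIrreducible.exists_inflation {H : Type*} [Group H] [FiniteDimensional ℂ V]
    {ρ : Representation ℂ H V} (hρ : ρ.IsIrreducible) {f : G →* H} (hf : Function.Surjective f) :
    ∃ (n : ℕ) (σ : Representation ℂ G (Fin n → ℂ)) (e : V ≃ₗ[ℂ] (Fin n → ℂ)),
      σ.IsIrreducible ∧ ∀ g v, σ g (e v) = e (ρ (f g) v) := by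
  let e := (Module.finBasis ℂ V).equivFun
  let σ : Representation ℂ G (Fin (Module.finrank ℂ V) → ℂ) :=
    (e.conjRingEquiv : Module.End ℂ V →* _).comp (MonoidHom.comp ρ f)
  have hσ : ∀ g v, σ g (e v) = e (ρ (f g) v) := fun g v ↦
    congrArg (fun w ↦ e (ρ (f g) w)) (e.symm_apply_apply v)
  refine ⟨_, σ, e, ?_, hσ⟩
  have := hρ.nontrivial_space
  have : Nontrivial (Fin (Module.finrank ℂ V) → ℂ) := e.symm.toEquiv.nontrivial
  refine isIrreducible_of_forall fun W hW ↦ ?_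
  have := hρ.eq_bot_or_eq_top (W.comap e.toLinearMap) fun h v hv ↦ by
    obtain ⟨g, rfl⟩ := hf h
    have := hW g (e v) hv
    rwa [hσ] at this
  refine this.imp (fun h ↦ ?_) (fun h ↦ ?_)
  · rw [eq_bot_iff]
    intro w hw
    have : e.symm w ∈ W.comap e.toLinearMap := by simpa using hw
    rw [h] at this
    simpa using this
  · rw [eq_top_iff]
    intro w _
    have : e.symm w ∈ W.comap e.toLinearMap := by rw [h]; trivial
    simpa using this

/-- Schur's lemma: an eigenspace of f is invariant and nonzero. -/
theorem IsIrreducible.exists_eq_smul_of_commute [FiniteDimensional ℂ V]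
    {ρ : Representation ℂ G V} (hρ : ρ.IsIrreducible) {f : Module.End ℂ V}
    (hf : ∀ g, Commute (ρ g) f) : ∃ c : ℂ, ∀ v, f v = c • v := by
  have := hρ.nontrivial_space
  obtain ⟨c, hcv⟩ := Module.End.exists_eigenvalue f
  refine ⟨c, fun v ↦ ?_⟩
  have h := (hρ.eq_bot_or_eq_top (f.eigenspace c) fun g v hv ↦ ?_).resolve_left hcv
  · exact Module.End.mem_eigenspace_iff.1 (h ▸ Submodule.mem_top)
  · rw [Module.End.mem_eigenspace_iff] at hv ⊢
    have := LinearMap.congr_fun (hf g) v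
    simp only [Module.End.mul_apply, hv, map_smul] at this
    exact this.symm

open scoped MonoidAlgebra in
-- By Maschke, the group algebra is a sum of simple submodules; if y fixed each of them pointwise,
-- it would fix 1.
theorem exists_isIrreducible_apply_ne {H : Type u} [Group H] [Finite H] {y : H} (hy : y ≠ 1) :
    ∃ (V : Type u) (_ : AddCommGroup V) (_ : Module ℂ V) (_ : FiniteDimensional ℂ V)
      (ρ : Representation ℂ H V) (v : V), ρ.IsIrreducible ∧ ρ y v ≠ v := by
  have hcard : NeZero (Nat.card H : ℂ) := ⟨by exact_mod_cast Nat.card_pos.ne'⟩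
  by_contra hcon
  push Not at hcon
  have hsimple : ∀ S : Submodule ℂ[H] ℂ[H], IsSimpleModule ℂ[H] S →
      ∀ s ∈ S, MonoidAlgebra.single y (1 : ℂ) • s = s := by
    intro S hS s hs
    have hfin : Module.Finite ℂ (RestrictScalars ℂ ℂ[H] S) := by
      let : Module ℂ[H] (RestrictScalars ℂ ℂ[H] S) := RestrictScalars.moduleOrig ℂ ℂ[H] S
      have h1 : Module.Finite ℂ[H] (RestrictScalars ℂ ℂ[H] S) :=
        inferInstanceAs (Module.Finite ℂ[H] S)
      exact Module.Finite.trans ℂ[H] _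
    have h := hcon (RestrictScalars ℂ ℂ[H] S) _ _ hfin
      (ofModule (k := ℂ) (G := H) S) (⟨s, hs⟩ : S)
      ((isSimpleModule_iff_irreducible_ofModule S).1 hS)
    exact congrArg Subtype.val h
  have hall : ∀ s : ℂ[H], MonoidAlgebra.single y (1 : ℂ) • s = s := by
    intro s
    have hs : s ∈ sSup {S : Submodule ℂ[H] ℂ[H] | IsSimpleModule ℂ[H] S} := by
      rw [IsSemisimpleModule.sSup_simples_eq_top]; trivial
    rw [sSup_eq_iSup'] at hs
    induction hs using Submodule.iSup_induction' with
    | mem S s hs => exact hsimple S S.2 s hs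
    | zero => simp
    | add s t _ _ hs ht => rw [smul_add, hs, ht]
  have h := hall (MonoidAlgebra.single 1 1)
  rw [smul_eq_mul, MonoidAlgebra.single_mul_single, mul_one, mul_one] at h
  exact hy (MonoidAlgebra.single_left_injective one_ne_zero h)

/-- The average of the powers of A is idempotent, so its trace is its rank. -/
theorem trace_geom_sum [FiniteDimensional ℂ V] {A : Module.End ℂ V} {m : ℕ} (hA : A ^ m = 1) :
    ∃ q : ℚ, ∑ i ∈ Finset.range m, LinearMap.trace ℂ V (A ^ i) = q := by
  rcases Nat.eq_zero_or_pos m with rfl | hm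
  · exact ⟨0, by simp⟩
  set S := ∑ i ∈ Finset.range m, A ^ i with hS
  have hAS : A * S = S := by
    have h := mul_neg_geom_sum A m
    rw [hA, sub_self, sub_mul, one_mul, sub_eq_zero] at h
    exact h.symm
  have hpow : ∀ i, A ^ i * S = S := by
    intro i
    induction i with
    | zero => simp
    | succ i ih => rw [pow_succ, mul_assoc, hAS, ih]
  have hSS : S * S = (m : ℂ) • S := by
    conv_lhs => rw [hS, Finset.sum_mul]
    rw [Finset.sum_congr rfl fun i _ ↦ hpow i]
    simp [Nat.cast_smul_eq_nsmul]
  have hm' : (m : ℂ) ≠ 0 := by exact_mod_cast hm.ne'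
  have hidem : IsIdempotentElem ((m : ℂ)⁻¹ • S) := by
    rw [IsIdempotentElem, smul_mul_smul_comm, hSS, smul_smul, mul_assoc, inv_mul_cancel₀ hm',
      mul_one]
  refine ⟨m * Module.finrank ℂ (LinearMap.range ((m : ℂ)⁻¹ • S)), ?_⟩
  have h := (LinearMap.IsIdempotentElem.isProj_range _ hidem).trace
  rw [map_smul, smul_eq_mul, inv_mul_eq_iff_eq_mul₀ hm', hS, map_sum] at h
  rw [h]; push_cast; rfl

/-- The sums of traces over all powers and over even powers are rational; their difference is m · tr
A. -/
theorem exists_rat_eq_trace [FiniteDimensional ℂ V] {A : Module.End ℂ V} {m : ℕ} (hm : m ≠ 0)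
    (hA : A ^ (2 * m) = 1)
    (h : ∀ i : ℕ, LinearMap.trace ℂ V (A ^ (2 * i + 1)) = LinearMap.trace ℂ V A) :
    ∃ q : ℚ, LinearMap.trace ℂ V A = q := by
  obtain ⟨q₁, h₁⟩ := trace_geom_sum hA
  obtain ⟨q₂, h₂⟩ := trace_geom_sum (A := A ^ 2) (m := m) (by rw [← pow_mul, hA])
  refine ⟨(q₁ - q₂) / m, ?_⟩
  have hsum : ∀ k, ∑ i ∈ Finset.range (2 * k), LinearMap.trace ℂ V (A ^ i) =
      ∑ i ∈ Finset.range k, LinearMap.trace ℂ V ((A ^ 2) ^ i) + k * LinearMap.trace ℂ V A := by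
    intro k
    induction k with
    | zero => simp
    | succ k ih =>
      rw [mul_add, mul_one, Finset.sum_range_succ, Finset.sum_range_succ, ih,
        Finset.sum_range_succ, h, ← pow_mul]
      push_cast; ring
  have hm' : (m : ℂ) ≠ 0 := by exact_mod_cast hm
  rw [hsum, h₂] at h₁
  push_cast
  rw [eq_div_iff hm', ← h₁]
  ring

end Representation

/-- ζ is a primitive 2^m-th root of unity with m ≥ 3, of degree 2^(m-1) ≥ 4. -/
theorem two_lt_rank_of_mem {F : IntermediateField ℚ ℂ} {ζ : ℂ} (hF : ζ ∈ F) {k : ℕ}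
    (hk : ζ ^ 2 ^ k = 1) (h4 : ζ ^ 4 ≠ 1) : 2 < Module.rank ℚ F := by
  obtain ⟨m, -, hm⟩ := (Nat.dvd_prime_pow Nat.prime_two).1 (orderOf_dvd_of_pow_eq_one hk)
  have hm3 : 3 ≤ m := by
    by_contra hlt
    refine h4 (orderOf_dvd_iff_pow_eq_one.1 ?_)
    rw [hm]
    exact pow_dvd_pow 2 (show m ≤ 2 by omega)
  have hprim : IsPrimitiveRoot ζ (2 ^ m) := hm ▸ IsPrimitiveRoot.orderOf ζ
  have hpos : 0 < 2 ^ m := by positivity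
  have hint : IsIntegral ℚ ζ := (hprim.isIntegral hpos).tower_top
  have hdeg : Module.finrank ℚ (IntermediateField.adjoin ℚ {ζ}) = 2 ^ (m - 1) := by
    rw [IntermediateField.adjoin.finrank hint,
      ← Polynomial.cyclotomic_eq_minpoly_rat hprim hpos, Polynomial.natDegree_cyclotomic,
      Nat.totient_prime_pow Nat.prime_two (by omega)]
    simp
  have hle : IntermediateField.adjoin ℚ {ζ} ≤ F := by simpa using hF
  have := IntermediateField.adjoin.finiteDimensional hint
  have hrank : Module.rank ℚ (IntermediateField.adjoin ℚ {ζ}) ≤ Module.rank ℚ F :=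
    Submodule.rank_mono (show (IntermediateField.adjoin ℚ {ζ}).toSubalgebra.toSubmodule ≤
      F.toSubalgebra.toSubmodule from hle)
  refine lt_of_lt_of_le ?_ hrank
  rw [← Module.finrank_eq_rank, hdeg]
  have : 2 < 2 ^ (m - 1) := lt_of_lt_of_le (by norm_num : 2 < 2 ^ 2)
    (Nat.pow_le_pow_right (by norm_num) (by omega))
  exact_mod_cast this

/-! ### Fields of values and rationality -/

section Characters

open Representation

variable {G : Type*} [Group G] (hc : ∀ a b : G, ⁅a, b⁆ ∈ Subgroup.center G)

include hc

/-- The image of x in G/N_x is central. If x^4 ∉ N_x, some irreducible representation of G/N_x is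
nontrivial on x^4, and there x acts as a scalar c with c^4 ≠ 1. The inflated character takes the
value c · n at x, so its field contains c. -/
theorem IsQuadraticRational.pow_four_mem [Finite G] (h2 : IsPGroup 2 G) (hG : IsQuadraticRational G)
    (x : G) : x ^ 4 ∈ (commutatorHom hc x).range := by
  by_contra hx
  set N := (commutatorHom hc x).range with hN
  have hNn : N.Normal := ⟨fun n hn g ↦ by
    rwa [Subgroup.mem_center_iff.1 (range_commutatorHom_le_center hc x hn) g, mul_inv_cancel_right]⟩
  have hy : ((x : G ⧸ N)) ^ 4 ≠ 1 := by
    rwa [← QuotientGroup.mk_pow, Ne, QuotientGroup.eq_one_iff]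
  have hcomm : ∀ h : G ⧸ N, Commute h (x : G ⧸ N) := by
    intro h
    obtain ⟨g, rfl⟩ := QuotientGroup.mk_surjective h
    have h1 : ((⁅g, x⁆ : G) : G ⧸ N) = 1 := (QuotientGroup.eq_one_iff _).2 ⟨g, rfl⟩
    rw [commutatorElement_def] at h1
    exact commutatorElement_eq_one_iff_mul_comm.1 h1
  obtain ⟨V, _, _, _, ρ, v, hρ, hv⟩ := exists_isIrreducible_apply_ne hy
  obtain ⟨c, hcρ⟩ := hρ.exists_eq_smul_of_commute (f := ρ (x : G ⧸ N))
    fun h ↦ (hcomm h).map ρ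
  have hpow : ∀ (m : ℕ) (w : V), ρ ((x : G ⧸ N) ^ m) w = c ^ m • w := by
    intro m w
    induction m with
    | zero => simp
    | succ m ih =>
      rw [pow_succ', map_mul, Module.End.mul_apply, ih, hcρ, smul_smul, pow_succ']
  have hc4 : c ^ 4 ≠ 1 := by
    intro h
    rw [hpow, h, one_smul] at hv
    exact hv rfl
  have hv0 : v ≠ 0 := by
    rintro rfl
    simp at hv
  obtain ⟨k, hk⟩ := h2 x
  have hck : c ^ 2 ^ k = 1 := by
    have h := hpow (2 ^ k) v
    rw [← QuotientGroup.mk_pow, hk, QuotientGroup.mk_one, map_one, Module.End.one_apply] at h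
    have h' : (c ^ 2 ^ k - 1) • v = 0 := by rw [sub_smul, one_smul, ← h, sub_self]
    exact sub_eq_zero.1 ((smul_eq_zero.1 h').resolve_right hv0)
  obtain ⟨n, σ, e, hσ, hσρ⟩ := hρ.exists_inflation (QuotientGroup.mk'_surjective N)
  have hn : n ≠ 0 := by
    rintro rfl
    exact hv0 (e.injective (Subsingleton.elim _ _))
  have hσx : σ x = c • LinearMap.id := by
    refine LinearMap.ext fun w ↦ ?_
    obtain ⟨u, rfl⟩ := e.surjective w
    rw [hσρ, QuotientGroup.mk'_apply, hcρ, map_smul]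
    rfl
  have hχ : σ.character x = c * n := by
    simp [Representation.character, hσx]
  have hmem : c ∈ fieldOfValues σ.character := by
    have h1 : c * n ∈ fieldOfValues σ.character :=
      hχ ▸ IntermediateField.subset_adjoin ℚ _ (Set.mem_range_self x)
    have h2 := div_mem h1 (natCast_mem (fieldOfValues σ.character) n)
    rwa [mul_div_cancel_right₀ _ (by exact_mod_cast hn)] at h2
  exact absurd (hG σ.character ⟨n, σ, hσ, rfl⟩) (not_le.2 (two_lt_rank_of_mem hmem hck hc4))

theorem isRationalGroup_of_sq_mem (h2 : IsPGroup 2 G)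
    (h : ∀ x, x ^ 2 ∈ (commutatorHom hc x).range) : IsRationalGroup G := by
  rintro _ ⟨n, ρ, -, rfl⟩ g
  obtain ⟨k, hk⟩ := h2 g
  -- The period 2 · 2^k is even even when k = 0.
  refine exists_rat_eq_trace (A := ρ g) (m := 2 ^ k) (by positivity) ?_ fun i ↦ ?_
  · rw [← map_pow, mul_comm, pow_mul, hk, one_pow, map_one]
  · have hconj : IsConj (g ^ ((2 * i + 1 : ℕ) : ℤ)) g := by
      rw [isConj_zpow_self_iff hc, Nat.cast_succ, add_sub_cancel_right, zpow_natCast, pow_mul]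
      exact pow_mem (h g) i
    rw [zpow_natCast] at hconj
    obtain ⟨c, hc⟩ := isConj_iff.1 hconj
    rw [← map_pow]
    change ρ.character _ = ρ.character _
    rw [← ρ.char_conj (g ^ (2 * i + 1)) c, hc]

end Characters

theorem mainTheorem7 (G : Type*) [Group G] [Finite G] (h2 : IsPGroup 2 G)
    (hclass : Group.nilpotencyClass G ≤ 2)
    (hG : IsQuadraticRational G ∨ IsSemiRational G) :
    ((∀ a b : G ⧸ Subgroup.center G, a * b = b * a) ∧
      Monoid.exponent (G ⧸ Subgroup.center G) ∣ 4 ∧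
      Monoid.exponent (Subgroup.center G) ∣ 4) ∧
    (IsRationalGroup G ∨
      (IsInverseSemiRational G ∧
        ∃ u : (ZMod (Monoid.exponent G))ˣ, (u : ZMod (Monoid.exponent G)) = 5 ∧
          semiRationality G =
            (-1 : (ZMod (Monoid.exponent G))ˣ) •
              (Subgroup.zpowers u : Set (ZMod (Monoid.exponent G))ˣ))) := by
  have hnil : Group.IsNilpotent G := h2.isNilpotent
  have hc := commutatorElement_mem_center_of_nilpotencyClass_le_two hclass
  have h4 : ∀ x, x ^ 4 ∈ (commutatorHom hc x).range :=
    hG.elim (fun h ↦ h.pow_four_mem hc h2) (fun h ↦ h.pow_four_mem hc h2)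
  have h4c : ∀ x : G, x ^ 4 ∈ Subgroup.center G := fun x ↦
    range_commutatorHom_le_center hc x (h4 x)
  refine ⟨⟨fun a b ↦ ?_, ?_, ?_⟩, ?_⟩
  · obtain ⟨a, rfl⟩ := QuotientGroup.mk_surjective a
    obtain ⟨b, rfl⟩ := QuotientGroup.mk_surjective b
    exact commutatorElement_eq_one_iff_mul_comm.1 ((QuotientGroup.eq_one_iff ⁅a, b⁆).2 (hc a b))
  · refine Monoid.exponent_dvd_of_forall_pow_eq_one fun a ↦ ?_
    obtain ⟨a, rfl⟩ := QuotientGroup.mk_surjective a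
    exact (QuotientGroup.eq_one_iff (a ^ 4)).2 (h4c a)
  · exact Monoid.exponent_dvd_of_forall_pow_eq_one fun a ↦
      Subtype.ext (pow_four_eq_one_of_mem_center hc h4 a.2)
  by_cases hsq : ∀ x, x ^ 2 ∈ (commutatorHom hc x).range
  · exact .inl (isRationalGroup_of_sq_mem hc h2 hsq)
  push Not at hsq
  obtain ⟨y, hy⟩ := hsq
  have hiff := fun r ↦ isUniformlySemiRational_iff hc h2 h4 hy (r := r)
  refine .inr ⟨(hiff _).2 (by norm_num), ?_⟩
  -- Since x^4 is central, x^16 = 1; exponents 1 and 2 would give y^2 = 1 ∈ N_y.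
  have hn : Monoid.exponent G = 4 ∨ Monoid.exponent G = 8 ∨ Monoid.exponent G = 16 := by
    have h16 : Monoid.exponent G ∣ 2 ^ 4 := Monoid.exponent_dvd_of_forall_pow_eq_one fun x ↦ by
      rw [show 2 ^ 4 = 4 * 4 by norm_num, pow_mul]
      exact pow_four_eq_one_of_mem_center hc h4 (h4c x)
    have hy2 : ¬ Monoid.exponent G ∣ 2 := fun h ↦ hy <| by
      rw [orderOf_dvd_iff_pow_eq_one.1 ((Monoid.order_dvd_exponent y).trans h)]
      exact one_mem _
    obtain ⟨m, hm, h⟩ := (Nat.dvd_prime_pow Nat.prime_two).1 h16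
    rw [h] at hy2 ⊢
    interval_cases m <;> simp_all
  obtain ⟨u, hu, hS⟩ := mem_neg_one_smul_zpowers_five_iff hn
  refine ⟨u, hu, Set.ext fun s ↦ ?_⟩
  rw [hS]
  exact exists_congr fun r ↦ and_congr_right fun _ ↦ hiff r
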